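/- Let $N\ge 2$ be an integer, let $$E_N=\Big\{u\in W^{1,N}(0,1):\ u(0)=0,\ \int_0^1|u'|^N\,dx=1\Big\}$$ (where $u(0)$ is the value at $0$ of the continuous representative of $u$ on $[0,1]$), and for $\beta\in\mathbb R$ and measurable $v:(0,1)\to\mathbb R$ let $$I_\beta(v)=\int_0^1 \exp\Big(\beta\,\log\frac{e}{s}\;\frac{v(s)^N}{s^{N-1}}\Big)\,ds\in[0,\infty].$$ For $j\ge 1$ let $w_j(t)=j^{1/N}t$ for $0\le t\le \frac1j$ and $w_j(t)=j^{-(N-1)/N}$ for $\frac1j\le t\le 1$ (the infinitesimal Moser sequence). Then: 1. If $N$ is even or $\beta\ge 0$, then $\sup_{v\in E_N}I_\beta(v)<\infty$ if and only if $\beta\le 1$. For every $\beta\in\mathbb R$ (and every $N\ge2$), $\sup_{v\in E_N}I_\beta(|v|)<\infty$ if and only if $\beta\le1$. 2. Let $\beta<1$, let $u_n\in E_N$ for all $n$, and let $u_n\rightharpoonup u$ weakly in $W^{1,N}(0,1)$. If $N$ is even or $\beta\ge0$, then $I_\beta(u_n)\to I_\beta(u)$. Without this restriction, $I_\beta(|u_n|)\to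 I_\beta(|u|)$. 3. $w_j\in E_N$ for all $j\ge1$, and $w_j\rightharpoonup 0$ weakly in $W^{1,N}(0,1)$. If $\beta>1$, then $I_\beta(w_j)\to+\infty$ as $j\to\infty$, whereas $I_1(w_j)\to 1=I_1(0)$. -/

import Mathlib

open MeasureTheory Set Filter Topology
open scoped ENNReal ContDiff

noncomputable section

namespace BlissMoser

instance factOneLeCast (N : ℕ) [h : Fact (2 ≤ N)] : Fact ((1 : ℝ≥0∞) ≤ (N : ℝ≥0∞)) :=
  ⟨by exact_mod_cast le_trans one_le_two h.out⟩

/-- Lebesgue measure on the interval `(0, 1)`. -/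
abbrev μ01 : Measure ℝ := volume.restrict (Ioo (0 : ℝ) 1)

/-- `φ ∈ C_c^∞(0, 1)`. -/
def IsTestFunction (φ : ℝ → ℝ) : Prop :=
  ContDiff ℝ ∞ φ ∧ HasCompactSupport φ ∧ tsupport φ ⊆ Ioo (0 : ℝ) 1

/-- `g` is the weak (distributional) derivative of `f` on `(0, 1)`. It is meant for `f`, `g`
that are integrable on `(0, 1)`; then both integrals exist. -/
def IsWeakDeriv (f g : ℝ → ℝ) : Prop :=
  ∀ φ : ℝ → ℝ, IsTestFunction φ → ∫ x, f x * deriv φ x ∂μ01 = -∫ x, g x * φ x ∂μ01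

theorem integrable_mul_test {N : ℕ} [Fact (2 ≤ N)] (f : Lp ℝ (N : ℝ≥0∞) μ01) {ψ : ℝ → ℝ}
    (hψ : Continuous ψ) (hc : HasCompactSupport ψ) : Integrable (fun x => f x * ψ x) μ01 := by
  obtain ⟨C, hC⟩ := hc.exists_bound_of_continuous hψ
  exact ((Lp.memLp f).integrable Fact.out).mul_bdd (c := C) hψ.aestronglyMeasurable
    (Eventually.of_forall hC)

/-- The Sobolev space `W^{1,N}(0, 1)`: the pairs `(u, u')` of a function `u ∈ L^N(0, 1)` and its
weak derivative `u' ∈ L^N(0, 1)`. It carries the norm `max (‖u‖_N) (‖u'‖_N)`, which is equivalent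
to the usual Sobolev norm. -/
def sobolev (N : ℕ) [Fact (2 ≤ N)] :
    Submodule ℝ (Lp ℝ (N : ℝ≥0∞) μ01 × Lp ℝ (N : ℝ≥0∞) μ01) where
  carrier := {p | IsWeakDeriv p.1 p.2}
  zero_mem' := by
    intro φ _
    have h : ((0 : Lp ℝ (N : ℝ≥0∞) μ01) : ℝ → ℝ) =ᵐ[μ01] 0 := Lp.coeFn_zero ℝ _ _
    have h1 : ∫ x, (0 : Lp ℝ (N : ℝ≥0∞) μ01) x * deriv φ x ∂μ01 = 0 :=
      integral_eq_zero_of_ae (by filter_upwards [h] with x hx; rw [hx]; simp)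
    have h2 : ∫ x, (0 : Lp ℝ (N : ℝ≥0∞) μ01) x * φ x ∂μ01 = 0 :=
      integral_eq_zero_of_ae (by filter_upwards [h] with x hx; rw [hx]; simp)
    simp only [Prod.fst_zero, Prod.snd_zero, h1, h2, neg_zero]
  add_mem' := by
    intro p q hp hq φ hφ
    have hd : Continuous (deriv φ) := hφ.1.continuous_deriv (by norm_num)
    have hdc : HasCompactSupport (deriv φ) := hφ.2.1.deriv
    have h1 : ∫ x, (p.1 + q.1) x * deriv φ x ∂μ01
        = ∫ x, p.1 x * deriv φ x ∂μ01 + ∫ x, q.1 x * deriv φ x ∂μ01 := by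
      rw [← integral_add (integrable_mul_test p.1 hd hdc) (integrable_mul_test q.1 hd hdc)]
      refine integral_congr_ae ?_
      filter_upwards [Lp.coeFn_add p.1 q.1] with x hx
      rw [hx, Pi.add_apply, add_mul]
    have h2 : ∫ x, (p.2 + q.2) x * φ x ∂μ01
        = ∫ x, p.2 x * φ x ∂μ01 + ∫ x, q.2 x * φ x ∂μ01 := by
      rw [← integral_add (integrable_mul_test p.2 hφ.1.continuous hφ.2.1)
        (integrable_mul_test q.2 hφ.1.continuous hφ.2.1)]
      refine integral_congr_ae ?_
      filter_upwards [Lp.coeFn_add p.2 q.2] with x hx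
      rw [hx, Pi.add_apply, add_mul]
    simp only [Prod.fst_add, Prod.snd_add]
    rw [h1, h2, hp φ hφ, hq φ hφ]
    ring
  smul_mem' := by
    intro c p hp φ hφ
    have h1 : ∫ x, (c • p.1) x * deriv φ x ∂μ01 = c * ∫ x, p.1 x * deriv φ x ∂μ01 := by
      rw [← integral_const_mul]
      refine integral_congr_ae ?_
      filter_upwards [Lp.coeFn_smul c p.1] with x hx
      rw [hx, Pi.smul_apply, smul_eq_mul, mul_assoc]
    have h2 : ∫ x, (c • p.2) x * φ x ∂μ01 = c * ∫ x, p.2 x * φ x ∂μ01 := by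
      rw [← integral_const_mul]
      refine integral_congr_ae ?_
      filter_upwards [Lp.coeFn_smul c p.2] with x hx
      rw [hx, Pi.smul_apply, smul_eq_mul, mul_assoc]
    simp only [Prod.smul_fst, Prod.smul_snd]
    rw [h1, h2, hp φ hφ]
    ring

/-- `W^{1,N}(0, 1)` as a normed space. -/
abbrev W (N : ℕ) [Fact (2 ≤ N)] : Type := sobolev N

/-- The function underlying an element of `W^{1,N}(0, 1)` (determined almost everywhere). -/
def W.fn {N : ℕ} [Fact (2 ≤ N)] (u : W N) : ℝ → ℝ := u.1.1

/-- The weak derivative of an element of `W^{1,N}(0, 1)`. -/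
def W.wd {N : ℕ} [Fact (2 ≤ N)] (u : W N) : ℝ → ℝ := u.1.2

/-- `u(0) = 0`, in the sense of the continuous representative of `u` on `[0, 1]`. -/
def VanishesAtZero {N : ℕ} [Fact (2 ≤ N)] (u : W N) : Prop :=
  ∃ c : ℝ → ℝ, ContinuousOn c (Icc 0 1) ∧ u.fn =ᵐ[μ01] c ∧ c 0 = 0

/-- `E_N = {u ∈ W^{1,N}(0, 1) : u(0) = 0, ∫₀¹ |u'|^N = 1}`. -/
def E (N : ℕ) [Fact (2 ≤ N)] : Set (W N) :=
  {u | VanishesAtZero u ∧ ∫ x, |u.wd x| ^ N ∂μ01 = 1}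

/-- `I_β(v) = ∫₀¹ exp (β log(e/s) v(s)^N / s^(N-1)) ds`, with values in `[0, ∞]`. -/
def I (N : ℕ) (β : ℝ) (v : ℝ → ℝ) : ℝ≥0∞ :=
  ∫⁻ s, ENNReal.ofReal
    (Real.exp (β * Real.log (Real.exp 1 / s) * (v s ^ N / s ^ (N - 1)))) ∂μ01

/-- Convergence of a sequence in the weak topology of `W^{1,N}(0, 1)`. -/
def WeaklyTendsto {N : ℕ} [Fact (2 ≤ N)] (u : ℕ → W N) (u₀ : W N) : Prop :=
  Tendsto (fun n => toWeakSpace ℝ (W N) (u n)) atTop (𝓝 (toWeakSpace ℝ (W N) u₀))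

/-- The functions `w_j` of the infinitesimal Moser sequence. -/
def moserFn (N j : ℕ) (t : ℝ) : ℝ :=
  if t ≤ 1 / (j : ℝ) then (j : ℝ) ^ (1 / (N : ℝ)) * t
  else 1 / (j : ℝ) ^ (((N : ℝ) - 1) / (N : ℝ))

/-- The almost everywhere derivative of `w_j`. -/
def moserDeriv (N j : ℕ) (t : ℝ) : ℝ :=
  if t ≤ 1 / (j : ℝ) then (j : ℝ) ^ (1 / (N : ℝ)) else 0

theorem continuous_moserFn (N j : ℕ) [h : Fact (2 ≤ N)] : Continuous (moserFn N j) := by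
  have hN : (2 : ℝ) ≤ N := by exact_mod_cast h.out
  unfold moserFn
  refine Continuous.if_le (by fun_prop) (by fun_prop) continuous_id continuous_const ?_
  rintro t ht
  rw [ht]
  rcases Nat.eq_zero_or_pos j with rfl | hj
  · have h1 : ((N : ℝ) - 1) / N ≠ 0 := by
      have h2 : (0 : ℝ) < ((N : ℝ) - 1) / N := div_pos (by linarith) (by linarith)
      exact h2.ne'
    simp [Real.zero_rpow h1]
  · have hj' : (0 : ℝ) < j := by exact_mod_cast hj
    have h1 : 1 / (N : ℝ) + ((N : ℝ) - 1) / N = 1 := by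
      have : (N : ℝ) ≠ 0 := by linarith
      field_simp
      ring
    rw [eq_div_iff (Real.rpow_pos_of_pos hj' _).ne', mul_right_comm, ← Real.rpow_add hj', h1,
      Real.rpow_one]
    field_simp

theorem memLp_moserFn (N j : ℕ) [Fact (2 ≤ N)] : MemLp (moserFn N j) (N : ℝ≥0∞) μ01 := by
  obtain ⟨C, hC⟩ := isCompact_Icc.exists_bound_of_continuousOn
    (s := Icc (0 : ℝ) 1) (continuous_moserFn N j).continuousOn
  refine MemLp.of_bound (continuous_moserFn N j).aestronglyMeasurable C ?_
  exact (ae_restrict_iff' measurableSet_Ioo).2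
    (Eventually.of_forall fun x hx => hC x (Ioo_subset_Icc_self hx))

theorem measurable_moserDeriv (N j : ℕ) : Measurable (moserDeriv N j) :=
  Measurable.ite measurableSet_Iic measurable_const measurable_const

theorem norm_moserDeriv_le (N j : ℕ) (t : ℝ) :
    ‖moserDeriv N j t‖ ≤ (j : ℝ) ^ (1 / (N : ℝ)) := by
  have h : 0 ≤ (j : ℝ) ^ (1 / (N : ℝ)) := Real.rpow_nonneg (Nat.cast_nonneg j) _
  unfold moserDeriv
  split_ifs
  · rw [Real.norm_of_nonneg h]
  · simpa using h

theorem memLp_moserDeriv (N j : ℕ) : MemLp (moserDeriv N j) (N : ℝ≥0∞) μ01 :=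
  MemLp.of_bound (measurable_moserDeriv N j).aestronglyMeasurable _
    (Eventually.of_forall (norm_moserDeriv_le N j))

theorem isWeakDeriv_moser (N j : ℕ) [Fact (2 ≤ N)] :
    IsWeakDeriv (moserFn N j) (moserDeriv N j) := by
  intro φ hφ
  have hd : Continuous (deriv φ) := hφ.1.continuous_deriv (by norm_num)
  have h0 : φ 0 = 0 := image_eq_zero_of_notMem_tsupport fun h => by simpa using hφ.2.2 h
  have h1 : φ 1 = 0 := image_eq_zero_of_notMem_tsupport fun h => by simpa using hφ.2.2 h
  have hu := continuous_moserFn N j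
  have i1 : IntervalIntegrable (fun x => moserFn N j x * deriv φ x) volume 0 1 :=
    (hu.mul hd).intervalIntegrable 0 1
  have i2 : IntervalIntegrable (fun x => moserDeriv N j x * φ x) volume 0 1 := by
    have h2 : IntervalIntegrable φ volume 0 1 := hφ.1.continuous.intervalIntegrable 0 1
    rw [intervalIntegrable_iff] at h2 ⊢
    exact Integrable.bdd_mul (c := (j : ℝ) ^ (1 / (N : ℝ))) h2
      (measurable_moserDeriv N j).aestronglyMeasurable
      (Eventually.of_forall (norm_moserDeriv_le N j))
  have key := intervalIntegral.integral_add i2 i1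
  rw [MeasureTheory.integral_eq_of_hasDerivAt_off_countable (a := 0) (b := 1)
    (fun x => moserFn N j x * φ x)
    (fun x => moserDeriv N j x * φ x + moserFn N j x * deriv φ x)
    (s := {1 / (j : ℝ)}) (countable_singleton _)
    (hu.mul hφ.1.continuous).continuousOn ?_ (i2.add i1)] at key
  · simp only [h0, h1, mul_zero, sub_zero] at key
    simp only [intervalIntegral.integral_of_le zero_le_one, integral_Ioc_eq_integral_Ioo] at key
    linarith
  · rintro x ⟨_, hx⟩
    have hφ' : HasDerivAt φ (deriv φ x) x :=
      (hφ.1.differentiable (by norm_num) x).hasDerivAt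
    refine HasDerivAt.mul ?_ hφ'
    rcases lt_or_gt_of_ne (show x ≠ 1 / (j : ℝ) from hx) with hlt | hgt
    · have : moserDeriv N j x = (j : ℝ) ^ (1 / (N : ℝ)) := by simp only [moserDeriv, if_pos hlt.le]
      rw [this]
      have hlin : HasDerivAt (fun t : ℝ => (j : ℝ) ^ (1 / (N : ℝ)) * t)
          ((j : ℝ) ^ (1 / (N : ℝ))) x := by
        simpa using (hasDerivAt_id x).const_mul ((j : ℝ) ^ (1 / (N : ℝ)))
      refine hlin.congr_of_eventuallyEq ?_
      filter_upwards [Iio_mem_nhds hlt] with t ht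
      simp only [moserFn, if_pos (le_of_lt (show t < _ from ht))]
    · have : moserDeriv N j x = 0 := by simp only [moserDeriv, if_neg (not_le.2 hgt)]
      rw [this]
      refine (hasDerivAt_const x (1 / (j : ℝ) ^ (((N : ℝ) - 1) / (N : ℝ)))).congr_of_eventuallyEq ?_
      filter_upwards [Ioi_mem_nhds hgt] with t ht
      simp only [moserFn, if_neg (not_le.2 (show _ < t from ht))]

theorem IsWeakDeriv.congr_ae {f g f' g' : ℝ → ℝ} (h : IsWeakDeriv f g)
    (hf : f' =ᵐ[μ01] f) (hg : g' =ᵐ[μ01] g) : IsWeakDeriv f' g' := by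
  intro φ hφ
  have h1 : ∫ x, f' x * deriv φ x ∂μ01 = ∫ x, f x * deriv φ x ∂μ01 :=
    integral_congr_ae (by filter_upwards [hf] with x hx; rw [hx])
  have h2 : ∫ x, g' x * φ x ∂μ01 = ∫ x, g x * φ x ∂μ01 :=
    integral_congr_ae (by filter_upwards [hg] with x hx; rw [hx])
  rw [h1, h2, h φ hφ]

/-- The infinitesimal Moser function `w_j` (for `j ≥ 1`) as an element of `W^{1,N}(0, 1)`. -/
def moser (N : ℕ) [Fact (2 ≤ N)] (j : ℕ) : W N :=
  ⟨((memLp_moserFn N j).toLp, (memLp_moserDeriv N j).toLp),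
    (isWeakDeriv_moser N j).congr_ae (memLp_moserFn N j).coeFn_toLp
      (memLp_moserDeriv N j).coeFn_toLp⟩

end BlissMoser

end

noncomputable section

namespace BlissMoser

/-! By du Bois-Reymond, an element of `E N` is almost everywhere the primitive from 0 of its weak
derivative g. Jensen's inequality gives |u(s)|^N ≤ s^(N-1) ∫₀ˢ |g|^N, so the ratio F(s) = |u(s)|^N /
s^(N-1) is at most 1 and the integrand of `I` is at most (e/s)^max(β,0). For β < 1 this majorant is
integrable; weak convergence gives pointwise convergence of the primitives, and dominated
convergence yields continuity.

At β = 1 the majorant e/s just fails to be integrable. Bounded energy saves the estimate: F can be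
close to 1 only on a set where any two points differ by a factor less than 2
(`lt_two_mul_of_near_extremal`). If u is nearly extremal at s, almost all energy is spent on (0, s),
so u hardly grows afterwards while s^(N-1) does. On such a set e/s has integral at most 3e;
elsewhere F ≤ θ < 1 and (e/s)^θ is integrable (`lintegral_exp_le_of_concentrated`).

For the Moser functions F(s) is js up to 1/j and (js)^(1-N) beyond, with peak value 1 at 1/j. If β >
1, a one-sided neighbourhood of the peak of length δ/j already carries an integral of order j^(γ-1)
with γ > 1. If β = 1, the part |js - 1| < δ contributes O(δ), and the rest tends to 1 by dominated
convergence. Weak convergence to 0 needs no description of the dual: a functional bounded below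
along a subsequence would be at least kε on a sum of k terms of very different scales, whose norm is
only of order k^(1/N). -/

/-! ### Weak derivatives and primitives on (0, 1). -/

theorem integrable_μ01_iff {g : ℝ → ℝ} :
    Integrable g μ01 ↔ IntervalIntegrable g volume 0 1 := by
  rw [intervalIntegrable_iff_integrableOn_Ioo_of_le zero_le_one]; rfl

theorem integral_μ01 (g : ℝ → ℝ) : ∫ x, g x ∂μ01 = ∫ x in (0 : ℝ)..1, g x := by
  rw [intervalIntegral.integral_of_le zero_le_one, integral_Ioc_eq_integral_Ioo]

theorem integral_μ01_of_tsupport {g : ℝ → ℝ} (hg : tsupport g ⊆ Ioo 0 1) :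
    ∫ x, g x ∂μ01 = ∫ x, g x :=
  setIntegral_eq_integral_of_forall_compl_eq_zero fun _ hx =>
    image_eq_zero_of_notMem_tsupport fun h => hx (hg h)

/-- The primitive of `g` that vanishes at `0`. -/
def prim (g : ℝ → ℝ) (s : ℝ) : ℝ := ∫ x in (0 : ℝ)..s, g x

theorem IsTestFunction.eq_zero {φ : ℝ → ℝ} (hφ : IsTestFunction φ) {x : ℝ}
    (hx : x ∉ Ioo (0 : ℝ) 1) :
    φ x = 0 :=
  image_eq_zero_of_notMem_tsupport fun h => hx (hφ.2.2 h)

/-- Integration by parts for absolutely continuous functions; the boundary terms vanish with φ, and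
Lebesgue differentiation recovers g almost everywhere. -/
theorem isWeakDeriv_prim {g : ℝ → ℝ} (hg : Integrable g μ01) : IsWeakDeriv (prim g) g := by
  intro φ hφ
  have hg' := integrable_μ01_iff.1 hg
  rw [integral_μ01, integral_μ01]
  unfold prim
  rw [AbsolutelyContinuousOnInterval.integral_mul_deriv_eq_deriv_mul
    (hg'.absolutelyContinuousOnInterval_intervalIntegral left_mem_uIcc)
    (hφ.1.contDiffOn.of_le (by norm_num)).absolutelyContinuousOnInterval, hφ.eq_zero (by simp),
    hφ.eq_zero (by simp), mul_zero, mul_zero, sub_zero, zero_sub]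
  congr 1
  apply intervalIntegral.integral_congr_ae
  filter_upwards [hg'.ae_hasDerivAt_integral] with x hx hx'
  have := (hx (uIoc_subset_uIcc hx') 0 left_mem_uIcc).deriv
  rw [this]

/-- A test function of integral zero is the derivative of a test function. -/
theorem IsTestFunction.exists_deriv_eq {k : ℝ → ℝ} (hk : IsTestFunction k) (h0 : ∫ x, k x = 0) :
    ∃ φ, IsTestFunction φ ∧ deriv φ = k := by
  have hd : ∀ x, HasDerivAt (prim k) (k x) x := fun x =>
    intervalIntegral.integral_hasDerivAt_right (hk.1.continuous.intervalIntegrable _ _)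
      (hk.1.continuous.stronglyMeasurableAtFilter _ _) hk.1.continuous.continuousAt
  have hd' : deriv (prim k) = k := funext fun x => (hd x).deriv
  -- The extra point 1/2 keeps the set nonempty when k = 0, so that it has extreme points a and b
  -- inside (0, 1).
  have hK : IsCompact (insert (1 / 2) (tsupport k)) := hk.2.1.isCompact.insert _
  have hne : (insert (1 / 2) (tsupport k)).Nonempty := insert_nonempty _ _
  have hsub : insert (1 / 2) (tsupport k) ⊆ Ioo (0 : ℝ) 1 :=
    insert_subset (by norm_num) hk.2.2
  obtain ⟨a, ha, hamin⟩ := hK.exists_isLeast hne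
  obtain ⟨b, hb, hbmax⟩ := hK.exists_isGreatest hne
  have hz : ∀ x, x ∉ Icc a b → k x = 0 := fun x hx =>
    image_eq_zero_of_notMem_tsupport fun h =>
      hx ⟨hamin (mem_insert_of_mem _ h), hbmax (mem_insert_of_mem _ h)⟩
  have ha' := hsub ha
  have hb' := hsub hb
  have hsupp : ∀ x, x ∉ Icc a b → prim k x = 0 := by
    intro x hx
    rcases lt_or_ge x a with hxa | hxa
    · unfold prim
      rw [intervalIntegral.integral_congr (g := fun _ => 0), intervalIntegral.integral_zero]
      intro t ht
      refine hz t fun h => ?_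
      have : t ≤ max 0 x := ht.2
      rcases max_choice 0 x with h' | h' <;> rw [h'] at this <;> linarith [h.1, ha'.1]
    · have hxb : b < x := not_le.1 fun h => hx ⟨hxa, h⟩
      unfold prim
      rw [intervalIntegral.integral_eq_integral_of_support_subset, h0]
      intro t ht
      have : t ∈ Icc a b := by
        by_contra h
        exact ht (hz t h)
      exact ⟨ha'.1.trans_le this.1, this.2.trans hxb.le⟩
  have hts : tsupport (prim k) ⊆ Icc a b :=
    closure_minimal (fun x hx => by_contra fun h => hx (hsupp x h)) isClosed_Icc
  refine ⟨prim k, ⟨?_, ?_, ?_⟩, hd'⟩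
  · rw [contDiff_infty_iff_deriv, hd']
    exact ⟨fun x => (hd x).differentiableAt, hk.1⟩
  · exact HasCompactSupport.of_support_subset_isCompact isCompact_Icc
      (subset_tsupport _ |>.trans hts)
  · exact hts.trans fun x hx => ⟨ha'.1.trans_le hx.1, hx.2.trans_lt hb'.2⟩

theorem IsTestFunction.sub_smul {h ψ : ℝ → ℝ} (hh : IsTestFunction h) (hψ : IsTestFunction ψ)
    (c : ℝ) : IsTestFunction (fun x => h x - c * ψ x) := by
  have hts : tsupport (fun x => h x - c * ψ x) ⊆ tsupport h ∪ tsupport ψ := by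
    refine closure_minimal (fun x hx => ?_) ((isClosed_tsupport _).union (isClosed_tsupport _))
    by_contra hn
    rw [mem_union, not_or] at hn
    apply hx
    simp [image_eq_zero_of_notMem_tsupport hn.1, image_eq_zero_of_notMem_tsupport hn.2]
  refine ⟨hh.1.sub (contDiff_const.mul hψ.1), ?_, hts.trans (union_subset hh.2.2 hψ.2.2)⟩
  exact (hh.2.1.isCompact.union hψ.2.1.isCompact).of_isClosed_subset (isClosed_tsupport _) hts

theorem IsTestFunction.integrable {h : ℝ → ℝ} (hh : IsTestFunction h) : Integrable h :=
  hh.1.continuous.integrable_of_hasCompactSupport hh.2.1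

theorem IsTestFunction.integrable_mul {f h : ℝ → ℝ} (hf : Integrable f μ01)
    (hh : IsTestFunction h) : Integrable (fun x => f x * h x) μ01 := by
  obtain ⟨C, hC⟩ := hh.2.1.exists_bound_of_continuous hh.1.continuous
  exact hf.mul_bdd (c := C) hh.1.continuous.aestronglyMeasurable (Eventually.of_forall hC)

theorem exists_isTestFunction_integral_eq_one :
    ∃ ψ : ℝ → ℝ, IsTestFunction ψ ∧ ∫ x, ψ x = 1 := by
  let b : ContDiffBump (1 / 2 : ℝ) := ⟨1 / 8, 1 / 4, by norm_num, by norm_num⟩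
  refine ⟨b.normed volume, ⟨b.contDiff_normed, b.hasCompactSupport_normed, ?_⟩, b.integral_normed⟩
  rw [b.tsupport_normed_eq, Real.closedBall_eq_Icc]
  intro x hx
  have h1 : 1 / 2 - 1 / 4 ≤ x := hx.1
  have h2 : x ≤ 1 / 2 + 1 / 4 := hx.2
  constructor <;> linarith

/-- The lemma of du Bois-Reymond on `(0, 1)`. -/
theorem ae_const_of_integral_mul_deriv_eq_zero {f : ℝ → ℝ} (hf : Integrable f μ01)
    (h : ∀ φ, IsTestFunction φ → ∫ x, f x * deriv φ x ∂μ01 = 0) :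
    ∃ c, f =ᵐ[μ01] fun _ => c := by
  obtain ⟨ψ, hψ, hψ1⟩ := exists_isTestFunction_integral_eq_one
  set c := ∫ x, f x * ψ x ∂μ01 with hc
  refine ⟨c, ?_⟩
  have key : ∀ k, IsTestFunction k → ∫ x, f x * k x ∂μ01 = c * ∫ x, k x := by
    intro k hk
    set m := ∫ x, k x with hm
    -- Subtracting m ψ removes the mean of k, which makes the difference an admissible derivative.
    obtain ⟨φ, hφ, hφd⟩ := (hk.sub_smul hψ m).exists_deriv_eq (by
      rw [integral_sub hk.integrable (hψ.integrable.const_mul m), integral_const_mul, hψ1]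
      ring)
    have := h φ hφ
    rw [hφd] at this
    have e : ∀ x, f x * (k x - m * ψ x) = f x * k x - m * (f x * ψ x) := fun x => by ring
    simp only [e] at this
    rw [integral_sub (hk.integrable_mul hf) ((hψ.integrable_mul hf).const_mul m),
      integral_const_mul] at this
    linarith
  have hz : ∀ᵐ x, x ∈ Ioo (0 : ℝ) 1 → f x - c = 0 := by
    refine isOpen_Ioo.ae_eq_zero_of_integral_contDiff_smul_eq_zero ?_ ?_
    · exact (IntegrableOn.locallyIntegrableOn (s := Ioo (0 : ℝ) 1) hf).sub
        ((locallyIntegrable_const c).locallyIntegrableOn _)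
    · intro k h1 h2 h3
      have hk : IsTestFunction k := ⟨h1, h2, h3⟩
      have e : ∀ x, k x • (f x - c) = f x * k x - c * k x := fun x => by
        rw [smul_eq_mul]; ring
      simp only [e]
      rw [← setIntegral_eq_integral_of_forall_compl_eq_zero (s := Ioo (0 : ℝ) 1)]
      · rw [integral_sub (hk.integrable_mul hf) (hk.integrable.integrableOn.const_mul c), key k hk,
          integral_const_mul, integral_μ01_of_tsupport h3, sub_self]
      · intro x hx
        simp [hk.eq_zero hx]
  rw [EventuallyEq, ae_restrict_iff' measurableSet_Ioo]
  filter_upwards [hz] with x hx hx'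
  linarith [hx hx']

theorem continuousOn_prim {g : ℝ → ℝ} (hg : Integrable g μ01) :
    ContinuousOn (prim g) (Icc 0 1) := by
  have h := (integrable_μ01_iff.1 hg).absolutelyContinuousOnInterval_intervalIntegral
    (c := 0) left_mem_uIcc
  simpa [uIcc_of_le, prim] using! h.continuousOn

theorem integrable_prim {g : ℝ → ℝ} (hg : Integrable g μ01) : Integrable (prim g) μ01 :=
  (continuousOn_prim hg).integrableOn_Icc.mono_set Ioo_subset_Icc_self

theorem eq_on_Icc_of_ae_eq {f g : ℝ → ℝ} (hf : ContinuousOn f (Icc 0 1))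
    (hg : ContinuousOn g (Icc 0 1)) (h : f =ᵐ[μ01] g) : EqOn f g (Icc 0 1) := by
  have h' : f =ᵐ[volume.restrict (Icc (0 : ℝ) 1)] g := by
    rwa [← restrict_Ioo_eq_restrict_Icc]
  exact Measure.eqOn_Icc_of_ae_eq volume zero_ne_one h' hf hg

theorem exists_ae_eq_prim_add {f g : ℝ → ℝ} (hf : Integrable f μ01) (hg : Integrable g μ01)
    (hw : IsWeakDeriv f g) : ∃ d, f =ᵐ[μ01] fun s => prim g s + d := by
  obtain ⟨d, hd⟩ := ae_const_of_integral_mul_deriv_eq_zero (hf.sub (integrable_prim hg)) (by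
    intro φ hφ
    have hdφ : IsTestFunction (deriv φ) := ⟨(contDiff_infty_iff_deriv.1 hφ.1).2, hφ.2.1.deriv,
      tsupport_deriv_subset.trans hφ.2.2⟩
    simp only [Pi.sub_apply, sub_mul]
    rw [integral_sub (hdφ.integrable_mul hf) (hdφ.integrable_mul (integrable_prim hg)), hw φ hφ,
      isWeakDeriv_prim hg φ hφ, sub_self])
  refine ⟨d, ?_⟩
  filter_upwards [hd] with x hx
  simp only [Pi.sub_apply] at hx
  linarith

theorem ae_eq_prim {f g c : ℝ → ℝ} (hf : Integrable f μ01) (hg : Integrable g μ01)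
    (hw : IsWeakDeriv f g) (hc : ContinuousOn c (Icc 0 1)) (hfc : f =ᵐ[μ01] c) (h0 : c 0 = 0) :
    f =ᵐ[μ01] prim g := by
  obtain ⟨d, hd⟩ := exists_ae_eq_prim_add hf hg hw
  -- Two continuous functions that agree almost everywhere agree at the endpoint 0 too, which forces
  -- d = 0.
  have h2 := eq_on_Icc_of_ae_eq hc ((continuousOn_prim hg).add continuousOn_const)
    (hfc.symm.trans hd) (left_mem_Icc.2 zero_le_one)
  have hd0 : d = 0 := by simpa [h0, prim] using h2.symm
  simpa [hd0] using hd

theorem μ01_Iic {a : ℝ} (ha : a ≤ 1) : μ01 (Iic a) = ENNReal.ofReal a := by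
  have h : Iic a ∩ Ioc 0 1 = Ioc 0 a := by
    ext x
    simp only [mem_inter_iff, mem_Iic, mem_Ioc]
    constructor
    · rintro ⟨h1, h2, _⟩; exact ⟨h2, h1⟩
    · rintro ⟨h1, h2⟩; exact ⟨h2, h1, h2.trans ha⟩
  rw [μ01, restrict_Ioo_eq_restrict_Ioc, Measure.restrict_apply measurableSet_Iic, h,
    Real.volume_Ioc, sub_zero]

theorem moserFn_zero (N j : ℕ) : moserFn N j 0 = 0 := by
  simp [moserFn]

/-! ### The logarithmic weight and the exponential integral. -/

variable {N : ℕ}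

theorem log_exp_one_div_pos {s : ℝ} (hs : s ∈ Ioo (0 : ℝ) 1) : 0 < Real.log (Real.exp 1 / s) := by
  apply Real.log_pos
  rw [lt_div_iff₀ hs.1]
  have := Real.add_one_le_exp 1
  linarith [hs.2]

theorem exp_log_div {s : ℝ} (hs : 0 < s) :
    Real.exp (Real.log (Real.exp 1 / s)) = Real.exp 1 / s :=
  Real.exp_log (by positivity)

/-- The integrand is (e/s)^θ, a constant times the integrable power s^(-θ). -/
theorem lintegral_exp_mul_log_lt_top {θ : ℝ} (hθ : θ < 1) :
    ∫⁻ s, ENNReal.ofReal (Real.exp (θ * Real.log (Real.exp 1 / s))) ∂μ01 < ⊤ := by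
  have h1 : Integrable (fun s : ℝ => Real.exp θ * s ^ (-θ)) μ01 :=
    (integrable_μ01_iff.2 (intervalIntegral.intervalIntegrable_rpow' (by linarith))).const_mul _
  refine lt_of_eq_of_lt (setLIntegral_congr_fun measurableSet_Ioo fun s hs => ?_)
    h1.lintegral_lt_top
  rw [Real.log_div (Real.exp_ne_zero _) hs.1.ne', Real.log_exp, mul_sub, mul_one, Real.exp_sub,
    Real.rpow_neg hs.1.le, Real.rpow_def_of_pos hs.1, mul_comm θ (Real.log s), div_eq_mul_inv]

/-- Where F ≤ θ the subcritical majorant applies. The remaining points are pairwise comparable, so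
they occupy an interval on which the critical majorant e/s has bounded integral. -/
theorem lintegral_exp_le_of_concentrated {F : ℝ → ℝ} {θ : ℝ}
    (hF1 : ∀ s ∈ Ioo (0 : ℝ) 1, F s ≤ 1)
    (hF : ∀ s ∈ Ioo (0 : ℝ) 1, ∀ r ∈ Ioo (0 : ℝ) 1, θ < F s → θ < F r → r < 2 * s) :
    ∫⁻ s, ENNReal.ofReal (Real.exp (Real.log (Real.exp 1 / s) * F s)) ∂μ01 ≤
      ∫⁻ s, ENNReal.ofReal (Real.exp (θ * Real.log (Real.exp 1 / s))) ∂μ01 +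
        ENNReal.ofReal (3 * Real.exp 1) := by
  have small : ∀ s ∈ Ioo (0 : ℝ) 1, F s ≤ θ →
      ENNReal.ofReal (Real.exp (Real.log (Real.exp 1 / s) * F s))
        ≤ ENNReal.ofReal (Real.exp (θ * Real.log (Real.exp 1 / s))) := by
    intro s hs h
    rw [mul_comm θ]
    exact ENNReal.ofReal_le_ofReal (Real.exp_le_exp.2
      (mul_le_mul_of_nonneg_left h (log_exp_one_div_pos hs).le))
  by_cases hex : ∃ s ∈ Ioo (0 : ℝ) 1, θ < F s
  swap
  · push Not at hex
    exact (setLIntegral_mono' measurableSet_Ioo fun s hs => small s hs (hex s hs)).trans le_self_add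
  -- Every point with F > θ lies in [t/2, 2t]. There e/s ≤ 2e/t, and the length 3t/2 makes the total
  -- 3e, independently of t.
  obtain ⟨t, ht, hFt⟩ := hex
  have hI : ∫⁻ s, (Icc (t / 2) (2 * t)).indicator
      (fun _ => ENNReal.ofReal (2 * Real.exp 1 / t)) s ∂μ01 ≤ ENNReal.ofReal (3 * Real.exp 1) := by
    calc _ ≤ ∫⁻ s, (Icc (t / 2) (2 * t)).indicator
          (fun _ => ENNReal.ofReal (2 * Real.exp 1 / t)) s := setLIntegral_le_lintegral _ _
      _ = ENNReal.ofReal (3 * Real.exp 1) := by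
          rw [lintegral_indicator_const measurableSet_Icc, Real.volume_Icc,
            ← ENNReal.ofReal_mul (by have := ht.1; positivity)]
          congr 1
          field_simp [ht.1.ne']
          ring
  refine le_trans ?_ (add_le_add le_rfl hI)
  rw [← lintegral_add_right _ (measurable_const.indicator measurableSet_Icc)]
  refine setLIntegral_mono' measurableSet_Ioo fun s hs => ?_
  rcases le_or_gt (F s) θ with h | h
  · exact (small s hs h).trans le_self_add
  · have h1 := hF s hs t ht h hFt
    have h2 := hF t ht s hs hFt h
    rw [indicator_of_mem (show s ∈ Icc (t / 2) (2 * t) from ⟨by linarith, h2.le⟩)]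
    refine le_trans (ENNReal.ofReal_le_ofReal ?_) le_add_self
    calc Real.exp (Real.log (Real.exp 1 / s) * F s) ≤ Real.exp (Real.log (Real.exp 1 / s)) :=
          Real.exp_le_exp.2 (mul_le_of_le_one_right (log_exp_one_div_pos hs).le (hF1 s hs))
      _ = Real.exp 1 / s := exp_log_div hs.1
      _ ≤ 2 * Real.exp 1 / t := by
          rw [div_le_div_iff₀ hs.1 ht.1]
          nlinarith [Real.exp_pos 1]

/-- A finite upper bound for `I N 1 |v|` on `E N`. -/
def criticalBound (N : ℕ) : ℝ≥0∞ :=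
  ∫⁻ s, ENNReal.ofReal (Real.exp ((1 - (1 / 10) ^ N) * Real.log (Real.exp 1 / s))) ∂μ01 +
    ENNReal.ofReal (3 * Real.exp 1)

theorem criticalBound_lt_top : criticalBound N < ⊤ := by
  refine ENNReal.add_lt_top.2 ⟨lintegral_exp_mul_log_lt_top ?_, ENNReal.ofReal_lt_top⟩
  have : (0 : ℝ) < (1 / 10) ^ N := by positivity
  linarith

theorem I_congr {β : ℝ} {v w : ℝ → ℝ} (h : v =ᵐ[μ01] w) : I N β v = I N β w :=
  lintegral_congr_ae (by filter_upwards [h] with s hs; rw [hs])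

theorem I_le_of_ae_le {β γ : ℝ} {v w : ℝ → ℝ}
    (h : ∀ᵐ s ∂μ01, β * (v s ^ N) ≤ γ * (w s ^ N)) : I N β v ≤ I N γ w := by
  refine lintegral_mono_ae ?_
  filter_upwards [h, ae_restrict_mem measurableSet_Ioo] with s hs hs01
  refine ENNReal.ofReal_le_ofReal (Real.exp_le_exp.2 ?_)
  have h1 := log_exp_one_div_pos hs01
  have h2 : 0 < s ^ (N - 1) := pow_pos hs01.1 _
  have e : ∀ c x : ℝ, c * Real.log (Real.exp 1 / s) * (x / s ^ (N - 1)) =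
      Real.log (Real.exp 1 / s) / s ^ (N - 1) * (c * x) := fun c x => by ring
  rw [e, e]
  exact mul_le_mul_of_nonneg_left hs (by positivity)

/-- This is how the restriction on N and β enters: it reduces bounds for v^N to bounds for |v|^N. -/
theorem mul_pow_le_mul_abs_pow {β : ℝ} (hβ : Even N ∨ 0 ≤ β) (x : ℝ) :
    β * x ^ N ≤ β * |x| ^ N := by
  rcases hβ with h | h
  · rw [h.pow_abs]
  · exact mul_le_mul_of_nonneg_left ((le_abs_self _).trans (abs_pow x N).le) h

/-! ### Energy estimates and concentration. -/

variable [hN : Fact (2 ≤ N)]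

theorem integrable_abs_pow {g : ℝ → ℝ} (hg : MemLp g (N : ℝ≥0∞) μ01) :
    Integrable (fun x => |g x| ^ N) μ01 := by
  have := hg.integrable_norm_pow (by have := hN.out; omega)
  simpa only [Real.norm_eq_abs] using this

theorem integrable_of_memLp {g : ℝ → ℝ} (hg : MemLp g (N : ℝ≥0∞) μ01) : Integrable g μ01 :=
  hg.integrable Fact.out

theorem intervalIntegrable_of_integrable {f : ℝ → ℝ} (hf : Integrable f μ01) {s r : ℝ}
    (hs : s ∈ Icc (0 : ℝ) 1) (hr : r ∈ Icc (0 : ℝ) 1) : IntervalIntegrable f volume s r := by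
  refine (integrable_μ01_iff.1 hf).mono_set ?_
  rw [uIcc_of_le zero_le_one]
  exact uIcc_subset_Icc hs hr

theorem abs_prim_sub_pow_le {g : ℝ → ℝ} (hg : MemLp g (N : ℝ≥0∞) μ01) {s r : ℝ} (hs : 0 ≤ s)
    (hsr : s ≤ r) (hr : r ≤ 1) :
    |prim g r - prim g s| ^ N ≤ (r - s) ^ (N - 1) * ∫ x in s..r, |g x| ^ N := by
  have hN2 := hN.out
  rcases hsr.eq_or_lt with rfl | hlt
  · simp [show N ≠ 0 by omega]
  have m0 : (0 : ℝ) ∈ Icc (0 : ℝ) 1 := by simp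
  have ms : s ∈ Icc (0 : ℝ) 1 := ⟨hs, hsr.trans hr⟩
  have mr : r ∈ Icc (0 : ℝ) 1 := ⟨hs.trans hsr, hr⟩
  have hgi := integrable_of_memLp hg
  have h1 : IntervalIntegrable (fun x => |g x|) volume s r :=
    intervalIntegrable_of_integrable hgi.abs ms mr
  have h2 : IntervalIntegrable (fun x => |g x| ^ N) volume s r :=
    intervalIntegrable_of_integrable (integrable_abs_pow hg) ms mr
  have e : prim g r - prim g s = ∫ x in s..r, g x :=
    intervalIntegral.integral_interval_sub_left (intervalIntegrable_of_integrable hgi m0 mr)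
      (intervalIntegrable_of_integrable hgi m0 ms)
  have hle : |prim g r - prim g s| ≤ ∫ x in s..r, |g x| := by
    rw [e]; exact intervalIntegral.abs_integral_le_integral_abs hsr
  -- Jensen's inequality for x^N and the average over (s, r] replaces Hölder's inequality and avoids
  -- fractional exponents.
  have hJ := (convexOn_pow (𝕜 := ℝ) N).map_set_average_le (t := Ioc s r) (μ := volume)
    (f := fun x => |g x|) (continuous_pow N).continuousOn isClosed_Ici (by simp [hlt]) (by simp)
    (Eventually.of_forall fun x => mem_Ici.2 (abs_nonneg (g x)))
    ((intervalIntegrable_iff_integrableOn_Ioc_of_le hsr).1 h1)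
    ((intervalIntegrable_iff_integrableOn_Ioc_of_le hsr).1 h2)
  have hd : 0 < r - s := sub_pos.2 hlt
  simp only [setAverage_eq, Real.volume_real_Ioc_of_le hsr, smul_eq_mul,
    ← intervalIntegral.integral_of_le hsr] at hJ
  rw [mul_pow, inv_pow, inv_mul_eq_div, div_le_iff₀ (pow_pos hd N)] at hJ
  calc |prim g r - prim g s| ^ N ≤ (∫ x in s..r, |g x|) ^ N :=
        pow_le_pow_left₀ (abs_nonneg _) hle N
    _ ≤ _ := hJ
    _ = (r - s) ^ (N - 1) * ∫ x in s..r, |g x| ^ N := by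
        obtain ⟨m, rfl⟩ : ∃ m, N = m + 1 := ⟨N - 1, by omega⟩
        rw [Nat.add_sub_cancel, pow_succ]
        field_simp

theorem integral_abs_pow_mono {g : ℝ → ℝ} (hg : MemLp g (N : ℝ≥0∞) μ01) {a b : ℝ} (ha : 0 ≤ a)
    (hab : a ≤ b) (hb : b ≤ 1) : ∫ x in a..b, |g x| ^ N ≤ ∫ x, |g x| ^ N ∂μ01 := by
  rw [integral_μ01]
  exact intervalIntegral.integral_mono_interval ha hab hb
    (Eventually.of_forall fun x => by positivity) (integrable_μ01_iff.1 (integrable_abs_pow hg))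

theorem abs_prim_pow_le {g : ℝ → ℝ} (hg : MemLp g (N : ℝ≥0∞) μ01) {s : ℝ} (hs : 0 ≤ s)
    (hs1 : s ≤ 1) : |prim g s| ^ N ≤ s ^ (N - 1) * ∫ x in (0 : ℝ)..s, |g x| ^ N := by
  simpa [prim] using abs_prim_sub_pow_le hg le_rfl hs hs1

theorem abs_prim_pow_le' {g : ℝ → ℝ} (hg : MemLp g (N : ℝ≥0∞) μ01) {s : ℝ} (hs : 0 ≤ s)
    (hs1 : s ≤ 1) : |prim g s| ^ N ≤ s ^ (N - 1) * ∫ x, |g x| ^ N ∂μ01 :=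
  (abs_prim_pow_le hg hs hs1).trans
    (mul_le_mul_of_nonneg_left (integral_abs_pow_mono hg le_rfl hs hs1) (by positivity))

/-- For N = 2 this is 1/2 ≤ 9/16, and each further factor 1/2 is below 3/4. -/
theorem half_pow_le : ((1 : ℝ) / 2) ^ (N - 1) ≤ (3 / 4) ^ N := by
  obtain ⟨m, rfl⟩ := Nat.exists_eq_add_of_le hN.out
  rw [show 2 + m - 1 = m + 1 by omega, pow_succ, pow_add, mul_comm]
  exact mul_le_mul (by norm_num) (pow_le_pow_left₀ (by norm_num) (by norm_num) m) (by positivity)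
    (by positivity)

/-- If the energy of `g` is at most `1`, then `|prim g|^N / s^(N-1)` is close to its maximal value
`1` only at points of comparable size. -/
theorem lt_two_mul_of_near_extremal {g : ℝ → ℝ} (hg : MemLp g (N : ℝ≥0∞) μ01)
    (h1 : ∫ x, |g x| ^ N ∂μ01 ≤ 1) {s r : ℝ} (hs : 0 < s) (hr1 : r ≤ 1)
    (hFs : 1 - (1 / 10) ^ N < |prim g s| ^ N / s ^ (N - 1))
    (hFr : 1 - (1 / 10) ^ N < |prim g r| ^ N / r ^ (N - 1)) : r < 2 * s := by
  by_contra! hsr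
  have hN2 := hN.out
  have hr : 0 < r := by linarith
  have hN0 : N ≠ 0 := by omega
  have hle : s ≤ r := by linarith
  have m0 : (0 : ℝ) ∈ Icc (0 : ℝ) 1 := by simp
  have ms : s ∈ Icc (0 : ℝ) 1 := ⟨hs.le, hle.trans hr1⟩
  have mr : r ∈ Icc (0 : ℝ) 1 := ⟨hr.le, hr1⟩
  -- ρ = r^((N-1)/N) is the largest value that the energy bound allows for |prim g r|. The increment
  -- from s to r costs at most ρ/10 and |prim g s| is at most 3ρ/4, so `prim g` cannot be nearly
  -- extremal at r.
  obtain ⟨ρ, hρ, hρN⟩ : ∃ ρ : ℝ, 0 < ρ ∧ ρ ^ N = r ^ (N - 1) :=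
    ⟨(r ^ (N - 1)) ^ (1 / (N : ℝ)), by positivity, by
      rw [one_div]; exact Real.rpow_inv_natCast_pow (by positivity) hN0⟩
  rw [lt_div_iff₀ (by positivity)] at hFs hFr
  have hGs : 1 - (1 / 10) ^ N < ∫ x in (0 : ℝ)..s, |g x| ^ N := by
    have h := hFs.trans_le (abs_prim_pow_le hg hs.le ms.2)
    rw [mul_comm] at h
    exact lt_of_mul_lt_mul_left h (by positivity)
  have hi := integrable_abs_pow hg
  have hsum : (∫ x in (0 : ℝ)..s, |g x| ^ N) + ∫ x in s..r, |g x| ^ N ≤ 1 := by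
    rw [intervalIntegral.integral_add_adjacent_intervals
      (intervalIntegrable_of_integrable hi m0 ms) (intervalIntegrable_of_integrable hi ms mr)]
    exact (integral_abs_pow_mono hg le_rfl hr.le hr1).trans h1
  have hD : |prim g r - prim g s| ≤ ρ / 10 := by
    refine le_of_pow_le_pow_left₀ hN0 (by positivity) ?_
    calc |prim g r - prim g s| ^ N ≤ (r - s) ^ (N - 1) * ∫ x in s..r, |g x| ^ N :=
          abs_prim_sub_pow_le hg hs.le hle hr1
      _ ≤ r ^ (N - 1) * (1 / 10) ^ N := by
          refine mul_le_mul (pow_le_pow_left₀ (by linarith) (by linarith) _) (by linarith)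
            (intervalIntegral.integral_nonneg hle fun x _ => by positivity) (by positivity)
      _ = (ρ / 10) ^ N := by rw [← hρN, ← mul_pow]; ring
  have ha : |prim g s| ≤ 3 / 4 * ρ := by
    refine le_of_pow_le_pow_left₀ hN0 (by positivity) ?_
    calc |prim g s| ^ N ≤ s ^ (N - 1) * ∫ x, |g x| ^ N ∂μ01 := abs_prim_pow_le' hg hs.le ms.2
      _ ≤ s ^ (N - 1) := mul_le_of_le_one_right (by positivity) h1
      _ ≤ (1 / 2 * r) ^ (N - 1) := pow_le_pow_left₀ hs.le (by linarith) _
      _ ≤ (3 / 4 * ρ) ^ N := by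
          rw [mul_pow, mul_pow, hρN]
          exact mul_le_mul_of_nonneg_right half_pow_le (by positivity)
  have hb : |prim g r| ≤ 17 / 20 * ρ := by
    have := abs_add_le (prim g s) (prim g r - prim g s)
    rw [add_sub_cancel] at this
    linarith
  have hb' : |prim g r| ^ N ≤ (17 / 20) ^ N * r ^ (N - 1) := by
    rw [← hρN, ← mul_pow]
    exact pow_le_pow_left₀ (abs_nonneg _) hb N
  have h3 : (1 : ℝ) - (1 / 10) ^ N < (17 / 20) ^ N :=
    lt_of_mul_lt_mul_right (hFr.trans_le hb') (by positivity)
  -- Since N ≥ 2, the case N = 2 is the worst: 0.7225 on one side against 0.99 on the other.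
  have h4 : ((17 : ℝ) / 20) ^ N ≤ (17 / 20) ^ 2 :=
    pow_le_pow_of_le_one (by norm_num) (by norm_num) hN2
  have h5 : ((1 : ℝ) / 10) ^ N ≤ (1 / 10) ^ 2 :=
    pow_le_pow_of_le_one (by norm_num) (by norm_num) hN2
  norm_num at h3 h4 h5
  linarith

/-! ### The uniform bound on `E N` for β ≤ 1. -/

theorem W.memLp_wd (u : W N) : MemLp u.wd (N : ℝ≥0∞) μ01 := Lp.memLp u.1.2

theorem W.memLp_fn (u : W N) : MemLp u.fn (N : ℝ≥0∞) μ01 := Lp.memLp u.1.1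

theorem VanishesAtZero.ae_eq_prim {u : W N} (hu : VanishesAtZero u) : u.fn =ᵐ[μ01] prim u.wd := by
  obtain ⟨c, hc, huc, h0⟩ := hu
  exact BlissMoser.ae_eq_prim (integrable_of_memLp u.memLp_fn) (integrable_of_memLp u.memLp_wd)
    u.2 hc huc h0

theorem ratio_le_one {g : ℝ → ℝ} (hg : MemLp g (N : ℝ≥0∞) μ01)
    (h1 : ∫ x, |g x| ^ N ∂μ01 ≤ 1) {s : ℝ} (hs : s ∈ Ioo (0 : ℝ) 1) :
    |prim g s| ^ N / s ^ (N - 1) ≤ 1 := by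
  have hp : 0 < s ^ (N - 1) := pow_pos hs.1 _
  rw [div_le_one hp]
  exact (abs_prim_pow_le' hg hs.1.le hs.2.le).trans (mul_le_of_le_one_right hp.le h1)

theorem I_one_abs_le {u : W N} (hu : u ∈ E N) :
    I N 1 (fun s => |u.fn s|) ≤ criticalBound N := by
  have h : (fun s => |u.fn s|) =ᵐ[μ01] fun s => |prim u.wd s| := by
    filter_upwards [hu.1.ae_eq_prim] with s hs; rw [hs]
  rw [I_congr h]
  unfold I
  simp only [one_mul]
  exact lintegral_exp_le_of_concentrated (fun s hs => ratio_le_one u.memLp_wd hu.2.le hs)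
    fun s hs r hr => lt_two_mul_of_near_extremal u.memLp_wd hu.2.le hs.1 hr.2.le

theorem I_abs_le {β : ℝ} (hβ : β ≤ 1) {u : W N} (hu : u ∈ E N) :
    I N β (fun s => |u.fn s|) ≤ criticalBound N :=
  (I_le_of_ae_le (Eventually.of_forall fun _ =>
    mul_le_mul_of_nonneg_right hβ (by positivity))).trans (I_one_abs_le hu)

theorem I_le {β : ℝ} (hβ : Even N ∨ 0 ≤ β) (hβ1 : β ≤ 1) {u : W N} (hu : u ∈ E N) :
    I N β u.fn ≤ criticalBound N :=
  (I_le_of_ae_le (Eventually.of_forall fun _ => mul_pow_le_mul_abs_pow hβ _)).trans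
    (I_abs_le hβ1 hu)

/-! ### Weak convergence and continuity for β < 1. -/

instance : IsProbabilityMeasure μ01 := ⟨by simp⟩

theorem weaklyTendsto_iff {u : ℕ → W N} {u₀ : W N} :
    WeaklyTendsto u u₀ ↔
      ∀ Λ : StrongDual ℝ (W N), Tendsto (fun n => Λ (u n)) atTop (𝓝 (Λ u₀)) := by
  refine WeakBilin.tendsto_iff_forall_eval_tendsto (B := (topDualPairing ℝ (W N)).flip) ?_
  intro x y hxy
  exact (SeparatingDual.eq_iff_forall_dual_eq (R := ℝ)).2 fun Λ => LinearMap.congr_fun hxy Λ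

/-- Integration over a measurable set, as a continuous functional on `L^N(0, 1)`. -/
def setIntegralCLM (N : ℕ) [Fact (2 ≤ N)] (A : Set ℝ) : Lp ℝ (N : ℝ≥0∞) μ01 →L[ℝ] ℝ :=
  LinearMap.mkContinuous
    { toFun := fun f => ∫ x in A, f x ∂μ01
      map_add' := fun f g => by
        rw [← integral_add (integrable_of_memLp (Lp.memLp f)).integrableOn
          (integrable_of_memLp (Lp.memLp g)).integrableOn]
        exact integral_congr_ae (ae_restrict_of_ae (Lp.coeFn_add f g))
      map_smul' := fun c f => by
        rw [RingHom.id_apply, smul_eq_mul, ← integral_const_mul]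
        exact integral_congr_ae (ae_restrict_of_ae (Lp.coeFn_smul c f)) } 1 (by
    intro f
    have hf := Lp.memLp f
    have hi := integrable_of_memLp hf
    calc ‖∫ x in A, f x ∂μ01‖ ≤ ∫ x in A, ‖f x‖ ∂μ01 := norm_integral_le_integral_norm _
      _ ≤ ∫ x, ‖f x‖ ∂μ01 :=
          setIntegral_le_integral hi.norm (Eventually.of_forall fun _ => norm_nonneg _)
      _ = (eLpNorm f 1 μ01).toReal := by
          rw [integral_norm_eq_lintegral_enorm hi.aestronglyMeasurable,
            eLpNorm_one_eq_lintegral_enorm]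
      _ ≤ (eLpNorm f N μ01).toReal :=
          ENNReal.toReal_mono hf.eLpNorm_ne_top
            (eLpNorm_le_eLpNorm_of_exponent_le Fact.out hi.aestronglyMeasurable)
      _ = 1 * ‖f‖ := by rw [one_mul, Lp.norm_def])

theorem setIntegralCLM_apply (A : Set ℝ) (f : Lp ℝ (N : ℝ≥0∞) μ01) :
    setIntegralCLM N A f = ∫ x in A, f x ∂μ01 := rfl

/-- The map sending `u` to its underlying function in `L^N(0, 1)`. -/
def fnCLM (N : ℕ) [Fact (2 ≤ N)] : W N →L[ℝ] Lp ℝ (N : ℝ≥0∞) μ01 :=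
  (ContinuousLinearMap.fst ℝ _ _).comp (sobolev N).subtypeL

/-- The map sending `u` to its weak derivative in `L^N(0, 1)`. -/
def wdCLM (N : ℕ) [Fact (2 ≤ N)] : W N →L[ℝ] Lp ℝ (N : ℝ≥0∞) μ01 :=
  (ContinuousLinearMap.snd ℝ _ _).comp (sobolev N).subtypeL

theorem prim_eq_setIntegral (g : ℝ → ℝ) {s : ℝ} (hs : s ∈ Ioo (0 : ℝ) 1) :
    prim g s = ∫ x in Iic s, g x ∂μ01 := by
  rw [prim, intervalIntegral.integral_of_le hs.1.le, Measure.restrict_restrict measurableSet_Iic]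
  congr 2
  ext x
  simp only [mem_Ioc, mem_inter_iff, mem_Iic, mem_Ioo]
  have := hs.2
  constructor
  · rintro ⟨h1, h2⟩; exact ⟨h2, h1, by linarith⟩
  · rintro ⟨h1, h2, _⟩; exact ⟨h2, h1⟩

/-- Integrating the weak derivative over (0, s) is a continuous functional on `W N`. -/
theorem WeaklyTendsto.tendsto_prim {u : ℕ → W N} {u₀ : W N} (h : WeaklyTendsto u u₀) {s : ℝ}
    (hs : s ∈ Ioo (0 : ℝ) 1) :
    Tendsto (fun n => prim (u n).wd s) atTop (𝓝 (prim u₀.wd s)) := by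
  simpa only [prim_eq_setIntegral _ hs] using!
    weaklyTendsto_iff.1 h ((setIntegralCLM N (Iic s)).comp (wdCLM N))

theorem WeaklyTendsto.tendsto_integral {u : ℕ → W N} {u₀ : W N} (h : WeaklyTendsto u u₀) :
    Tendsto (fun n => ∫ x, (u n).fn x ∂μ01) atTop (𝓝 (∫ x, u₀.fn x ∂μ01)) := by
  have := weaklyTendsto_iff.1 h ((setIntegralCLM N univ).comp (fnCLM N))
  simp only [ContinuousLinearMap.comp_apply, setIntegralCLM_apply, Measure.restrict_univ] at this
  exact this

theorem abs_prim_pow_le_of_mem_E {u : W N} (hu : u ∈ E N) {s : ℝ} (hs : s ∈ Ioo (0 : ℝ) 1) :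
    |prim u.wd s| ^ N ≤ s ^ (N - 1) := by
  simpa [hu.2] using abs_prim_pow_le' u.memLp_wd hs.1.le hs.2.le

/-- The boundary condition at `0` is preserved by weak limits. -/
theorem WeaklyTendsto.ae_eq_prim {u : ℕ → W N} {u₀ : W N} (h : WeaklyTendsto u u₀)
    (hu : ∀ n, u n ∈ E N) : u₀.fn =ᵐ[μ01] prim u₀.wd := by
  have hi₀ := integrable_of_memLp u₀.memLp_wd
  obtain ⟨d, hd⟩ := exists_ae_eq_prim_add (integrable_of_memLp u₀.memLp_fn) hi₀ u₀.2
  -- The integrals of `u n` converge to that of `prim u₀.wd` by dominated convergence and to that of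
  -- `u₀` by weak convergence, so the additive constant d is zero.
  have h1 : Tendsto (fun n => ∫ x, prim (u n).wd x ∂μ01) atTop (𝓝 (∫ x, prim u₀.wd x ∂μ01)) := by
    refine tendsto_integral_of_dominated_convergence (fun _ => 1) (fun n =>
      (integrable_prim (integrable_of_memLp (u n).memLp_wd)).aestronglyMeasurable)
      (integrable_const _) (fun n => ?_) ?_
    · filter_upwards [ae_restrict_mem measurableSet_Ioo] with s hs
      rw [Real.norm_eq_abs]
      refine (pow_le_one_iff_of_nonneg (abs_nonneg _) (by have := hN.out; omega)).1
        ((abs_prim_pow_le_of_mem_E (hu n) hs).trans (pow_le_one₀ hs.1.le hs.2.le))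
    · filter_upwards [ae_restrict_mem measurableSet_Ioo] with s hs using h.tendsto_prim hs
  have h2 := h.tendsto_integral
  simp only [fun n => integral_congr_ae (hu n).1.ae_eq_prim] at h2
  have h3 := tendsto_nhds_unique h1 h2
  rw [integral_congr_ae hd, integral_add (integrable_prim hi₀) (integrable_const d)] at h3
  have hd0 : d = 0 := by simpa using h3
  simpa [hd0] using hd

/-- Taking φ to be the identity or the absolute value treats both versions of the functional at
once. -/
theorem tendsto_I_of_weaklyTendsto {β : ℝ} (hβ1 : β < 1) {φ : ℝ → ℝ} (hφ : Continuous φ)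
    (hφβ : ∀ x, β * φ x ^ N ≤ β * |x| ^ N) {u : ℕ → W N} {u₀ : W N}
    (hu : ∀ n, u n ∈ E N) (h : WeaklyTendsto u u₀) :
    Tendsto (fun n => I N β (fun s => φ ((u n).fn s))) atTop
      (𝓝 (I N β (fun s => φ (u₀.fn s)))) := by
  have hae : ∀ᵐ s ∂μ01, ∀ n, (u n).fn s = prim (u n).wd s :=
    ae_all_iff.2 fun n => (hu n).1.ae_eq_prim
  refine tendsto_lintegral_of_dominated_convergence'
    -- With `max β 0` in place of β the ratio bound F ≤ 1 can be used for negative β as well.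
    (fun s => ENNReal.ofReal (Real.exp (max β 0 * Real.log (Real.exp 1 / s)))) (fun n => ?_)
    (fun n => ?_) (lintegral_exp_mul_log_lt_top (max_lt hβ1 one_pos)).ne ?_
  · have := (hφ.comp_aestronglyMeasurable (u n).memLp_fn.1).aemeasurable
    have h2 : AEMeasurable (fun s => φ ((u n).fn s)) μ01 := this
    have h3 : Measurable fun s : ℝ => β * Real.log (Real.exp 1 / s) := by fun_prop
    have h4 : Measurable fun s : ℝ => s ^ (N - 1) := by fun_prop
    exact (h3.aemeasurable.mul ((h2.pow_const N).div h4.aemeasurable)).exp.ennreal_ofReal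
  · filter_upwards [hae, ae_restrict_mem measurableSet_Ioo] with s hs hs01
    rw [hs n]
    refine ENNReal.ofReal_le_ofReal (Real.exp_le_exp.2 ?_)
    have hl := log_exp_one_div_pos hs01
    have hp : 0 < s ^ (N - 1) := pow_pos hs01.1 _
    have h1 : β * φ (prim (u n).wd s) ^ N ≤ max β 0 * s ^ (N - 1) :=
      (hφβ _).trans (mul_le_mul (le_max_left _ _) (abs_prim_pow_le_of_mem_E (hu n) hs01)
        (by positivity) (le_max_right _ _))
    rw [show β * Real.log (Real.exp 1 / s) * (φ (prim (u n).wd s) ^ N / s ^ (N - 1)) =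
      β * φ (prim (u n).wd s) ^ N / s ^ (N - 1) * Real.log (Real.exp 1 / s) by ring]
    exact mul_le_mul_of_nonneg_right ((div_le_iff₀ hp).2 h1) hl.le
  · filter_upwards [hae, h.ae_eq_prim hu, ae_restrict_mem measurableSet_Ioo] with s hs hs₀ hs01
    simp only [hs, hs₀]
    refine (ENNReal.continuous_ofReal.comp Real.continuous_exp).continuousAt.tendsto.comp ?_
    exact ((((hφ.tendsto _).comp (h.tendsto_prim hs01)).pow N).div_const _).const_mul _

/-! ### The functional along the Moser sequence. -/

theorem moser_fn_ae (j : ℕ) : (moser N j).fn =ᵐ[μ01] moserFn N j := (memLp_moserFn N j).coeFn_toLp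

theorem moser_wd_ae (j : ℕ) : (moser N j).wd =ᵐ[μ01] moserDeriv N j :=
  (memLp_moserDeriv N j).coeFn_toLp

theorem rpow_one_div_pow (j : ℕ) : ((j : ℝ) ^ (1 / (N : ℝ))) ^ N = j := by
  rw [one_div]
  exact Real.rpow_inv_natCast_pow (Nat.cast_nonneg j) (by have := hN.out; omega)

theorem abs_moserDeriv_pow (j : ℕ) (x : ℝ) :
    |moserDeriv N j x| ^ N = (Iic (1 / (j : ℝ))).indicator (fun _ => (j : ℝ)) x := by
  have h0 : N ≠ 0 := by have := hN.out; omega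
  by_cases hx : x ≤ 1 / (j : ℝ)
  · rw [indicator_of_mem (mem_Iic.2 hx), moserDeriv, if_pos hx,
      abs_of_nonneg (Real.rpow_nonneg (Nat.cast_nonneg j) _), rpow_one_div_pow]
  · rw [indicator_of_notMem (by simpa using hx), moserDeriv, if_neg hx]
    simp [h0]

theorem moser_mem_E {j : ℕ} (hj : 1 ≤ j) : moser N j ∈ E N := by
  have hj' : (1 : ℝ) ≤ j := by exact_mod_cast hj
  refine ⟨⟨moserFn N j, (continuous_moserFn N j).continuousOn, moser_fn_ae j, moserFn_zero N j⟩, ?_⟩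
  have h : ∫ x, |(moser N j).wd x| ^ N ∂μ01 =
      ∫ x, (Iic (1 / (j : ℝ))).indicator (fun _ => (j : ℝ)) x ∂μ01 := by
    refine integral_congr_ae ?_
    filter_upwards [moser_wd_ae (N := N) j] with x hx
    rw [hx, abs_moserDeriv_pow]
  rw [h, integral_indicator_const _ measurableSet_Iic, measureReal_def,
    μ01_Iic (by rw [div_le_one (by linarith)]; exact hj'), ENNReal.toReal_ofReal (by positivity),
    smul_eq_mul, one_div_mul_cancel (by linarith)]

theorem moserFn_ratio_of_le {j : ℕ} {s : ℝ} (hs : 0 < s) (hsj : s ≤ 1 / (j : ℝ)) :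
    moserFn N j s ^ N / s ^ (N - 1) = j * s := by
  have h : s ^ N = s ^ (N - 1) * s := (pow_sub_one_mul (by have := hN.out; omega) s).symm
  rw [moserFn, if_pos hsj, mul_pow, rpow_one_div_pow, h]
  field_simp

theorem moserFn_ratio_of_lt {j : ℕ} {s : ℝ} (hsj : 1 / (j : ℝ) < s) :
    moserFn N j s ^ N / s ^ (N - 1) = 1 / ((j : ℝ) * s) ^ (N - 1) := by
  have hN2 := hN.out
  have h0 : (N : ℝ) ≠ 0 := by positivity
  have h : ((j : ℝ) ^ (((N : ℝ) - 1) / N)) ^ N = (j : ℝ) ^ (N - 1) := by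
    rw [← Real.rpow_natCast, ← Real.rpow_mul (Nat.cast_nonneg j), div_mul_cancel₀ _ h0,
      ← Real.rpow_natCast, Nat.cast_sub (by omega), Nat.cast_one]
  rw [moserFn, if_neg hsj.not_ge, div_pow, h, one_pow, div_div, mul_pow]

theorem moserFn_ratio_nonneg (j : ℕ) {s : ℝ} (hs : 0 < s) :
    0 ≤ moserFn N j s ^ N / s ^ (N - 1) := by
  rcases le_or_gt s (1 / (j : ℝ)) with h | h
  · rw [moserFn_ratio_of_le hs h]; positivity
  · rw [moserFn_ratio_of_lt h]; positivity

theorem moserFn_ratio_le_of_lt {j : ℕ} (hj : 1 ≤ j) {s : ℝ} (hsj : 1 / (j : ℝ) < s) :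
    moserFn N j s ^ N / s ^ (N - 1) ≤ 1 / (j * s) := by
  have hN2 := hN.out
  have hj' : (1 : ℝ) ≤ j := by exact_mod_cast hj
  rw [moserFn_ratio_of_lt hsj]
  have h1 : 1 < j * s := by rwa [div_lt_iff₀' (by linarith)] at hsj
  exact one_div_le_one_div_of_le (by linarith) (le_self_pow₀ h1.le (by omega))

theorem tendsto_I_moser_top {β : ℝ} (hβ : 1 < β) :
    Tendsto (fun j => I N β (moser N j).fn) atTop (𝓝 ⊤) := by
  -- δ is chosen so that β(1 - δ) = γ > 1. On ((1 - δ)/j, 1/j) the ratio is at least 1 - δ and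
  -- log(e/s) ≥ log j, so the integrand is at least j^γ on a set of measure δ/j.
  set γ := (β + 1) / 2 with hγ
  set δ := (β - 1) / (2 * β) with hδ
  have hδ0 : 0 < δ := div_pos (by linarith) (by linarith)
  have hβδ : β * (1 - δ) = γ := by rw [hδ, hγ]; field_simp; ring
  have hδ1 : δ < 1 := by rw [hδ, div_lt_one (by linarith)]; linarith
  have hlim : Tendsto (fun j : ℕ => ENNReal.ofReal (δ * (j : ℝ) ^ (γ - 1))) atTop (𝓝 ⊤) :=
    ENNReal.tendsto_ofReal_nhds_top.2 (((tendsto_rpow_atTop (by rw [hγ]; linarith)).comp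
      tendsto_natCast_atTop_atTop).const_mul_atTop hδ0)
  refine tendsto_nhds_top_mono hlim ?_
  filter_upwards [eventually_ge_atTop 1] with j hj
  have hj' : (1 : ℝ) ≤ j := by exact_mod_cast hj
  have hj0 : (0 : ℝ) < j := by linarith
  rw [I_congr (moser_fn_ae j)]
  set S := Ioo ((1 - δ) / j) (1 / (j : ℝ)) with hS
  have hS01 : S ⊆ Ioo 0 1 := fun s hs =>
    ⟨(div_pos (by linarith) hj0).trans hs.1, hs.2.trans_le ((div_le_one hj0).2 hj')⟩
  calc ENNReal.ofReal (δ * (j : ℝ) ^ (γ - 1))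
      = ENNReal.ofReal ((j : ℝ) ^ γ) * μ01 S := by
        rw [Measure.restrict_eq_self _ hS01, hS, Real.volume_Ioo,
          ← ENNReal.ofReal_mul (by positivity), Real.rpow_sub_one hj0.ne']
        congr 1
        ring
    _ = ∫⁻ s, S.indicator (fun _ => ENNReal.ofReal ((j : ℝ) ^ γ)) s ∂μ01 :=
        (lintegral_indicator_const measurableSet_Ioo _).symm
    _ ≤ I N β (moserFn N j) := by
        refine lintegral_mono fun s => ?_
        by_cases hs : s ∈ S
        swap
        · simp [indicator_of_notMem hs]
        rw [indicator_of_mem hs, moserFn_ratio_of_le (hS01 hs).1 hs.2.le,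
          Real.rpow_def_of_pos hj0]
        refine ENNReal.ofReal_le_ofReal (Real.exp_le_exp.2 ?_)
        have hs0 := (hS01 hs).1
        have hjs : 1 - δ ≤ j * s := by
          have := hs.1
          rw [div_lt_iff₀' hj0] at this
          exact this.le
        have hlog : Real.log j ≤ Real.log (Real.exp 1 / s) := by
          refine Real.log_le_log hj0 ?_
          have h1 : (j : ℝ) ≤ 1 / s := (le_one_div hj0 hs0).2 hs.2.le
          refine h1.trans (div_le_div_of_nonneg_right ?_ hs0.le)
          have := Real.add_one_le_exp 1
          linarith
        have hl0 := log_exp_one_div_pos (hS01 hs)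
        rw [← hβδ, show β * Real.log (Real.exp 1 / s) * (j * s) =
          Real.log (Real.exp 1 / s) * (β * (j * s)) by ring]
        exact mul_le_mul hlog (mul_le_mul_of_nonneg_left hjs (by linarith))
          (mul_nonneg (by linarith) (by linarith)) hl0.le

theorem one_le_I_moser (j : ℕ) : 1 ≤ I N 1 (moser N j).fn := by
  rw [I_congr (moser_fn_ae j)]
  calc (1 : ℝ≥0∞) = ∫⁻ _, 1 ∂μ01 := by simp
    _ ≤ _ := by
      refine setLIntegral_mono' measurableSet_Ioo fun s hs => ?_
      rw [← ENNReal.ofReal_one, one_mul]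
      exact ENNReal.ofReal_le_ofReal (Real.one_le_exp
        (mul_nonneg (log_exp_one_div_pos hs).le (moserFn_ratio_nonneg j hs.1)))

/-- The ratio `w_j(s)^N / s^(N-1)`, set to zero where `s` is comparable to `1 / j`. -/
def moserTail (N j : ℕ) (δ s : ℝ) : ℝ :=
  if |j * s - 1| < δ then 0 else moserFn N j s ^ N / s ^ (N - 1)

theorem moserTail_nonneg (j : ℕ) (δ : ℝ) {s : ℝ} (hs : 0 < s) : 0 ≤ moserTail N j δ s := by
  unfold moserTail
  split_ifs
  · exact le_rfl
  · exact moserFn_ratio_nonneg j hs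

/-- Off the peak the ratio is at most 1 - δ on the left and 1/(1 + δ) on the right; both are at most
1 - δ/2 for δ ≤ 1. This leaves a subcritical majorant uniform in j. -/
theorem moserTail_le {j : ℕ} (hj : 1 ≤ j) {δ s : ℝ} (hδ : 0 < δ) (hδ1 : δ ≤ 1) (hs : 0 < s) :
    moserTail N j δ s ≤ 1 - δ / 2 := by
  have hj' : (0 : ℝ) < j := by exact_mod_cast hj
  unfold moserTail
  split_ifs with h
  · linarith
  · rw [not_lt] at h
    rcases le_or_gt s (1 / (j : ℝ)) with hsj | hsj
    · rw [moserFn_ratio_of_le hs hsj]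
      rw [le_div_iff₀' hj'] at hsj
      rw [abs_of_nonpos (by linarith)] at h
      linarith
    · refine (moserFn_ratio_le_of_lt hj hsj).trans ?_
      rw [div_lt_iff₀' hj'] at hsj
      rw [abs_of_pos (by linarith)] at h
      rw [div_le_iff₀ (by linarith)]
      nlinarith

theorem tendsto_moserTail {δ s : ℝ} (hδ1 : δ ≤ 1) (hs : 0 < s) :
    Tendsto (fun j => moserTail N j δ s) atTop (𝓝 0) := by
  have hlim : Tendsto (fun j : ℕ => 1 / ((j : ℝ) * s)) atTop (𝓝 0) :=
    tendsto_const_nhds.div_atTop (tendsto_natCast_atTop_atTop.atTop_mul_const hs)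
  refine tendsto_of_tendsto_of_tendsto_of_le_of_le' tendsto_const_nhds hlim
    (Eventually.of_forall fun j => moserTail_nonneg j δ hs) ?_
  filter_upwards [eventually_ge_atTop 1,
    (tendsto_natCast_atTop_atTop.atTop_mul_const hs).eventually_ge_atTop 2] with j hj hjs
  have hj' : (0 : ℝ) < j := by exact_mod_cast hj
  rw [moserTail, if_neg]
  · refine moserFn_ratio_le_of_lt hj ?_
    rw [div_lt_iff₀' hj']
    linarith
  · rw [abs_of_nonneg (by linarith)]
    linarith

theorem measurable_moserTail (j : ℕ) (δ : ℝ) : Measurable (moserTail N j δ) := by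
  refine Measurable.ite (measurableSet_lt (by fun_prop) measurable_const) measurable_const ?_
  exact ((continuous_moserFn N j).measurable.pow_const N).div (measurable_id.pow_const _)

theorem tendsto_lintegral_moserTail {δ : ℝ} (hδ : 0 < δ) (hδ1 : δ ≤ 1) :
    Tendsto (fun j => ∫⁻ s, ENNReal.ofReal
      (Real.exp (Real.log (Real.exp 1 / s) * moserTail N j δ s)) ∂μ01) atTop (𝓝 1) := by
  have h1 : ∫⁻ _, 1 ∂μ01 = 1 := by simp
  -- The majorant holds only for j ≥ 1, whereas dominated convergence asks for it at every index.
  rw [← tendsto_add_atTop_iff_nat 1]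
  rw [← h1]
  refine tendsto_lintegral_of_dominated_convergence
    (fun s => ENNReal.ofReal (Real.exp ((1 - δ / 2) * Real.log (Real.exp 1 / s)))) (fun j => ?_)
    (fun j => ?_) (lintegral_exp_mul_log_lt_top (by linarith)).ne ?_
  · have := measurable_moserTail (N := N) (j + 1) δ
    fun_prop
  · filter_upwards [ae_restrict_mem measurableSet_Ioo] with s hs
    rw [mul_comm (1 - δ / 2)]
    exact ENNReal.ofReal_le_ofReal (Real.exp_le_exp.2 (mul_le_mul_of_nonneg_left
      (moserTail_le (by omega) hδ hδ1 hs.1) (log_exp_one_div_pos hs).le))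
  · filter_upwards [ae_restrict_mem measurableSet_Ioo] with s hs
    have h := ((tendsto_add_atTop_iff_nat 1).2 (tendsto_moserTail (N := N) hδ1 hs.1)).const_mul
      (Real.log (Real.exp 1 / s))
    have h2 := (ENNReal.continuous_ofReal.comp Real.continuous_exp).continuousAt.tendsto.comp h
    simpa using! h2

/-- Near the peak s ≥ 1/(2j), because δ ≤ 1/2, so the integrand is at most e/s ≤ 2ej on an interval
of length 2δ/j. -/
theorem I_moser_le {j : ℕ} (hj : 1 ≤ j) {δ : ℝ} (hδ : 0 < δ) (hδ1 : δ ≤ 1 / 2) :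
    I N 1 (moser N j).fn ≤ ∫⁻ s, ENNReal.ofReal
      (Real.exp (Real.log (Real.exp 1 / s) * moserTail N j δ s)) ∂μ01 +
        ENNReal.ofReal (4 * Real.exp 1 * δ) := by
  have hj' : (0 : ℝ) < j := by exact_mod_cast hj
  rw [I_congr (moser_fn_ae j)]
  set S := Ioo ((1 - δ) / j) ((1 + δ) / (j : ℝ)) with hS
  have hI : ∫⁻ s, S.indicator (fun _ => ENNReal.ofReal (2 * Real.exp 1 * j)) s ∂μ01 ≤
      ENNReal.ofReal (4 * Real.exp 1 * δ) := by
    calc _ ≤ ∫⁻ s, S.indicator (fun _ => ENNReal.ofReal (2 * Real.exp 1 * j)) s :=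
          setLIntegral_le_lintegral _ _
      _ = _ := by
          rw [lintegral_indicator_const measurableSet_Ioo, Real.volume_Ioo,
            ← ENNReal.ofReal_mul (by positivity)]
          congr 1
          field_simp
          ring
  refine le_trans ?_ (add_le_add le_rfl hI)
  rw [← lintegral_add_right _ (measurable_const.indicator measurableSet_Ioo)]
  refine setLIntegral_mono' measurableSet_Ioo fun s hs => ?_
  rw [one_mul]
  by_cases h : |j * s - 1| < δ
  · have h' := abs_lt.1 h
    rw [indicator_of_mem (show s ∈ S from ⟨by rw [div_lt_iff₀' hj']; linarith,
      by rw [lt_div_iff₀' hj']; linarith⟩)]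
    refine le_trans (ENNReal.ofReal_le_ofReal ?_) le_add_self
    have hr : moserFn N j s ^ N / s ^ (N - 1) ≤ 1 := by
      rcases le_or_gt s (1 / (j : ℝ)) with hsj | hsj
      · rw [moserFn_ratio_of_le hs.1 hsj]
        rwa [le_div_iff₀' hj'] at hsj
      · refine (moserFn_ratio_le_of_lt hj hsj).trans ?_
        rw [div_lt_iff₀' hj'] at hsj
        rw [div_le_one (by linarith)]
        exact hsj.le
    calc _ ≤ Real.exp (Real.log (Real.exp 1 / s)) :=
          Real.exp_le_exp.2 (mul_le_of_le_one_right (log_exp_one_div_pos hs).le hr)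
      _ = Real.exp 1 / s := exp_log_div hs.1
      _ ≤ 2 * Real.exp 1 * j := by
          rw [div_le_iff₀ hs.1]
          nlinarith [Real.exp_pos 1]
  · rw [moserTail, if_neg h]
    exact le_self_add

theorem tendsto_I_moser_one : Tendsto (fun j => I N 1 (moser N j).fn) atTop (𝓝 1) := by
  refine tendsto_order.2 ⟨fun a ha => Eventually.of_forall fun j => ha.trans_le (one_le_I_moser j),
    fun a ha => ?_⟩
  have hc : Tendsto (fun δ : ℝ => 1 + ENNReal.ofReal (4 * Real.exp 1 * δ)) (𝓝[>] 0) (𝓝 1) := by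
    have : Continuous fun δ : ℝ => 1 + ENNReal.ofReal (4 * Real.exp 1 * δ) :=
      continuous_const.add (ENNReal.continuous_ofReal.comp (continuous_const.mul continuous_id))
    simpa using (this.tendsto 0).mono_left nhdsWithin_le_nhds
  obtain ⟨δ, hδa, hδ0, hδ1⟩ := ((hc.eventually_lt_const ha).and
    (Ioc_mem_nhdsGT (show (0 : ℝ) < 1 / 2 by norm_num))).exists
  have hA := (tendsto_lintegral_moserTail (N := N) hδ0 (hδ1.trans (by norm_num))).add_const
    (ENNReal.ofReal (4 * Real.exp 1 * δ))
  filter_upwards [hA.eventually_lt_const hδa, eventually_ge_atTop 1] with j hj hj1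
  exact (I_moser_le hj1 hδ0 hδ1).trans_lt hj

theorem I_zero : I N 1 (W.fn (0 : W N)) = 1 := by
  have h : W.fn (0 : W N) =ᵐ[μ01] fun _ => 0 := Lp.coeFn_zero ℝ _ _
  rw [I_congr h]
  have h0 : N ≠ 0 := by have := hN.out; omega
  simp [I, h0]

/-! ### Weak convergence of the Moser sequence to zero. -/

theorem norm_Lp_pow (f : Lp ℝ (N : ℝ≥0∞) μ01) : ‖f‖ ^ N = ∫ x, |f x| ^ N ∂μ01 := by
  have hN2 := hN.out
  have h0 : (N : ℝ≥0∞) ≠ 0 := by exact_mod_cast (by omega : N ≠ 0)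
  rw [Lp.norm_def, (Lp.memLp f).eLpNorm_eq_integral_rpow_norm h0 (ENNReal.natCast_ne_top N),
    ENNReal.toReal_ofReal (by positivity), ENNReal.toReal_natCast,
    Real.rpow_inv_natCast_pow (by positivity) (by omega)]
  simp only [Real.rpow_natCast, Real.norm_eq_abs]

theorem abs_moserFn_le {j : ℕ} (hj : 1 ≤ j) {s : ℝ} (hs : 0 < s) :
    |moserFn N j s| ≤ 1 / (j : ℝ) ^ (((N : ℝ) - 1) / N) := by
  have hj' : (0 : ℝ) < j := by exact_mod_cast hj
  have h0 : (N : ℝ) ≠ 0 := by have := hN.out; positivity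
  unfold moserFn
  split_ifs with h
  · rw [abs_of_nonneg (by positivity)]
    refine (mul_le_mul_of_nonneg_left h (by positivity)).trans_eq ?_
    rw [eq_div_iff (by positivity), mul_right_comm, ← Real.rpow_add hj',
      show 1 / (N : ℝ) + ((N : ℝ) - 1) / N = 1 by field_simp; ring, Real.rpow_one]
    field_simp
  · rw [abs_of_nonneg (by positivity)]

theorem tendsto_norm_moser_fst :
    Tendsto (fun j => ‖(moser N j).1.1‖) atTop (𝓝 0) := by
  have h2 : (2 : ℝ) ≤ N := by exact_mod_cast hN.out
  have hlim : Tendsto (fun j : ℕ => 1 / (j : ℝ) ^ (((N : ℝ) - 1) / N)) atTop (𝓝 0) :=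
    tendsto_const_nhds.div_atTop ((tendsto_rpow_atTop (div_pos (by linarith) (by linarith))).comp
      tendsto_natCast_atTop_atTop)
  refine squeeze_zero' (Eventually.of_forall fun j => norm_nonneg _) ?_ hlim
  filter_upwards [eventually_ge_atTop 1] with j hj
  have := Lp.norm_le_of_ae_bound (f := (moser N j).1.1)
    (C := 1 / (j : ℝ) ^ (((N : ℝ) - 1) / N)) (by positivity) (by
      filter_upwards [moser_fn_ae (N := N) j, ae_restrict_mem measurableSet_Ioo] with s hs hs01
      rw [Real.norm_eq_abs, show (moser N j).1.1 s = moserFn N j s from hs]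
      exact abs_moserFn_le hj hs01.1)
  simpa [measureUnivNNReal] using this

/-- For large j the new slope dominates: on (0, 1/j] the summed slope is at most 2 j^(1/N), which
costs 2^N in energy, and beyond 1/j nothing changes. Energies are therefore nearly additive. -/
theorem integral_abs_add_moser_pow_le {u : W N} {M : ℝ} (hM : ∀ᵐ x ∂μ01, |u.wd x| ≤ M) {j : ℕ}
    (hj : 1 ≤ j) (hMj : M ≤ (j : ℝ) ^ (1 / (N : ℝ))) :
    ∫ x, |(u + moser N j).wd x| ^ N ∂μ01 ≤ ∫ x, |u.wd x| ^ N ∂μ01 + 2 ^ N := by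
  have hj1 : (1 : ℝ) ≤ j := by exact_mod_cast hj
  have hind : Integrable ((Iic (1 / (j : ℝ))).indicator (fun _ => (2 : ℝ) ^ N * j)) μ01 :=
    (integrable_const _).indicator measurableSet_Iic
  calc ∫ x, |(u + moser N j).wd x| ^ N ∂μ01
      ≤ ∫ x, (|u.wd x| ^ N + (Iic (1 / (j : ℝ))).indicator (fun _ => (2 : ℝ) ^ N * j) x) ∂μ01 := by
        refine integral_mono_ae (integrable_abs_pow (u + moser N j).memLp_wd)
          ((integrable_abs_pow u.memLp_wd).add hind) ?_
        filter_upwards [Lp.coeFn_add u.1.2 (moser N j).1.2, moser_wd_ae (N := N) j, hM]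
          with x hx hx2 hx3
        have e : (u + moser N j).wd x = u.wd x + moserDeriv N j x := by
          rw [← hx2]; exact hx
        rw [e]
        by_cases h : x ≤ 1 / (j : ℝ)
        · rw [indicator_of_mem (mem_Iic.2 h), ← rpow_one_div_pow (N := N) j, ← mul_pow]
          have h1 : |u.wd x + moserDeriv N j x| ≤ 2 * (j : ℝ) ^ (1 / (N : ℝ)) := by
            have h2 := norm_moserDeriv_le N j x
            rw [Real.norm_eq_abs] at h2
            linarith [abs_add_le (u.wd x) (moserDeriv N j x)]
          have h3 := pow_le_pow_left₀ (abs_nonneg _) h1 N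
          have h4 : 0 ≤ |u.wd x| ^ N := by positivity
          linarith
        · rw [indicator_of_notMem (by simpa using h), moserDeriv, if_neg h, add_zero, add_zero]
    _ = ∫ x, |u.wd x| ^ N ∂μ01 + 2 ^ N := by
        rw [integral_add (integrable_abs_pow u.memLp_wd) hind,
          integral_indicator_const _ measurableSet_Iic, measureReal_def,
          μ01_Iic (by rw [div_le_one (by linarith)]; exact hj1),
          ENNReal.toReal_ofReal (by positivity), smul_eq_mul]
        field_simp

/-- A functional that stays above `ε` along a subsequence of `w_j` is at least `k ε` on a sum of
`k` terms that are so far apart that the energy of the sum is of order `k`. -/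
theorem exists_sum_moser {Λ : StrongDual ℝ (W N)} {ε : ℝ}
    (hΛ : ∃ᶠ j in atTop, ε ≤ Λ (moser N j)) (k : ℕ) :
    ∃ u : W N, (∃ M, ∀ᵐ x ∂μ01, |u.wd x| ≤ M) ∧ ∫ x, |u.wd x| ^ N ∂μ01 ≤ 2 ^ N * k ∧
      ‖u.1.1‖ < 1 ∧ k * ε ≤ Λ u := by
  have hN2 := hN.out
  induction k with
  | zero =>
    have h : W.wd (0 : W N) =ᵐ[μ01] fun _ => 0 := Lp.coeFn_zero ℝ _ _
    refine ⟨0, ⟨0, ?_⟩, ?_, by simp, by simp⟩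
    · filter_upwards [h] with x hx
      simp [hx]
    · rw [integral_congr_ae (g := fun _ => 0) (by
        filter_upwards [h] with x hx
        simp [hx, show N ≠ 0 by omega])]
      simp
  | succ k ih =>
    obtain ⟨u, ⟨M, hM⟩, hE, hn, hk⟩ := ih
    -- The strict bound on ‖u‖_N leaves room for one more term, since the functions themselves tend
    -- to 0 in norm.
    have h1 : ∀ᶠ j in atTop, ‖(moser N j).1.1‖ < 1 - ‖u.1.1‖ :=
      tendsto_norm_moser_fst.eventually_lt_const (by linarith)
    have h2 : ∀ᶠ j : ℕ in atTop, M ≤ (j : ℝ) ^ (1 / (N : ℝ)) :=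
      ((tendsto_rpow_atTop (by positivity)).comp
        tendsto_natCast_atTop_atTop).eventually_ge_atTop M
    obtain ⟨j, hj, hj1, hj2, hj3⟩ :=
      (hΛ.and_eventually (h1.and (h2.and (eventually_ge_atTop 1)))).exists
    refine ⟨u + moser N j, ⟨M + (j : ℝ) ^ (1 / (N : ℝ)), ?_⟩, ?_, ?_, ?_⟩
    · filter_upwards [Lp.coeFn_add u.1.2 (moser N j).1.2, moser_wd_ae (N := N) j, hM]
        with x hx hx2 hx3
      have e : (u + moser N j).wd x = u.wd x + moserDeriv N j x := by
        rw [← hx2]; exact hx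
      have h3 := norm_moserDeriv_le N j x
      rw [Real.norm_eq_abs] at h3
      rw [e]
      linarith [abs_add_le (u.wd x) (moserDeriv N j x)]
    · refine (integral_abs_add_moser_pow_le hM hj3 hj2).trans ?_
      push_cast
      linarith
    · have := norm_add_le u.1.1 (moser N j).1.1
      exact this.trans_lt (by linarith)
    · rw [map_add]
      push_cast
      linarith

theorem eventually_apply_moser_lt (Λ : StrongDual ℝ (W N)) {ε : ℝ} (hε : 0 < ε) :
    ∀ᶠ j in atTop, Λ (moser N j) < ε := by
  by_contra hcon
  have hΛ : ∃ᶠ j in atTop, ε ≤ Λ (moser N j) := by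
    simpa only [Filter.Frequently, not_le] using hcon
  have hN2 := hN.out
  obtain ⟨m, hm⟩ := exists_nat_gt (2 * ‖Λ‖ / ε)
  have hm0 : (0 : ℝ) < m := lt_of_le_of_lt (by positivity) hm
  have hm1 : (1 : ℝ) ≤ m := by exact_mod_cast Nat.cast_pos.1 hm0
  -- With m² terms the derivative has norm at most 2m, because m² ≤ m^N. Then m² ε ≤ 2m ‖Λ‖, against
  -- the choice of m.
  obtain ⟨u, -, hE, hn, hk⟩ := exists_sum_moser hΛ (m ^ 2)
  have h2 : ‖u.1.2‖ ≤ 2 * m := by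
    refine le_of_pow_le_pow_left₀ (show N ≠ 0 by omega) (by positivity) ?_
    rw [norm_Lp_pow, mul_pow]
    refine hE.trans (mul_le_mul_of_nonneg_left ?_ (by positivity))
    push_cast
    exact pow_le_pow_right₀ hm1 hN2
  have h3 : ‖u‖ ≤ 2 * m := by
    change ‖u.1‖ ≤ 2 * m
    rw [Prod.norm_def]
    exact max_le (by linarith) h2
  have h4 : Λ u ≤ ‖Λ‖ * (2 * m) :=
    (Real.le_norm_self _).trans ((Λ.le_opNorm u).trans
      (mul_le_mul_of_nonneg_left h3 (norm_nonneg _)))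
  rw [div_lt_iff₀ hε] at hm
  push_cast at hk
  nlinarith

theorem weaklyTendsto_moser : WeaklyTendsto (moser N) 0 := by
  refine weaklyTendsto_iff.2 fun Λ => ?_
  rw [map_zero, tendsto_order]
  refine ⟨fun a ha => ?_, fun a ha => eventually_apply_moser_lt Λ ha⟩
  filter_upwards [eventually_apply_moser_lt (-Λ) (neg_pos.2 ha)] with j hj
  exact neg_lt_neg_iff.1 hj

/-! ### Suprema over `E N` and the theorem. -/

theorem iSup_E_lt_top {f : W N → ℝ≥0∞} (h : ∀ u ∈ E N, f u ≤ criticalBound N) :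
    ⨆ v ∈ E N, f v < ⊤ :=
  (iSup₂_le h).trans_lt criticalBound_lt_top

theorem iSup_E_eq_top {f : W N → ℝ≥0∞}
    (h : Tendsto (fun j => f (moser N j)) atTop (𝓝 ⊤)) : ⨆ v ∈ E N, f v = ⊤ := by
  refine top_le_iff.1 (le_of_tendsto h ?_)
  filter_upwards [eventually_ge_atTop 1] with j hj
  exact le_iSup₂ (f := fun v (_ : v ∈ E N) => f v) (moser N j) (moser_mem_E hj)

theorem tendsto_I_abs_moser_top {β : ℝ} (hβ : 1 < β) :
    Tendsto (fun j => I N β (fun s => |(moser N j).fn s|)) atTop (𝓝 ⊤) :=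
  tendsto_nhds_top_mono (tendsto_I_moser_top hβ) (Eventually.of_forall fun _ =>
    I_le_of_ae_le (Eventually.of_forall fun _ => mul_pow_le_mul_abs_pow (Or.inr (by linarith)) _))

end BlissMoser

end

theorem theorem1p1 (N : ℕ) [Fact (2 ≤ N)] :
    -- boundedness on `E_N`, for `v^N` (with `β ≥ 0` if `N` is odd) and for `|v|^N`
    (∀ β : ℝ, (Even N ∨ 0 ≤ β) →
      ((⨆ v ∈ BlissMoser.E N, BlissMoser.I N β v.fn) < ⊤ ↔ β ≤ 1)) ∧
    (∀ β : ℝ, (⨆ v ∈ BlissMoser.E N, BlissMoser.I N β (fun s => |v.fn s|)) < ⊤ ↔ β ≤ 1) ∧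
    -- weak sequential continuity on `E_N`, for `v^N` and for `|v|^N`
    (∀ β : ℝ, (Even N ∨ 0 ≤ β) → β < 1 →
      ∀ (u : ℕ → BlissMoser.W N) (u₀ : BlissMoser.W N), (∀ n, u n ∈ BlissMoser.E N) →
        BlissMoser.WeaklyTendsto u u₀ →
        Tendsto (fun n => BlissMoser.I N β (u n).fn) atTop (𝓝 (BlissMoser.I N β u₀.fn))) ∧
    (∀ β : ℝ, β < 1 →
      ∀ (u : ℕ → BlissMoser.W N) (u₀ : BlissMoser.W N), (∀ n, u n ∈ BlissMoser.E N) →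
        BlissMoser.WeaklyTendsto u u₀ →
        Tendsto (fun n => BlissMoser.I N β (fun s => |(u n).fn s|)) atTop
          (𝓝 (BlissMoser.I N β (fun s => |u₀.fn s|)))) ∧
    -- the infinitesimal Moser sequence
    (∀ j : ℕ, 1 ≤ j → BlissMoser.moser N j ∈ BlissMoser.E N) ∧
    BlissMoser.WeaklyTendsto (BlissMoser.moser N) 0 ∧
    (∀ β : ℝ, 1 < β →
      Tendsto (fun j => BlissMoser.I N β (BlissMoser.moser N j).fn) atTop (𝓝 ⊤)) ∧
    Tendsto (fun j => BlissMoser.I N 1 (BlissMoser.moser N j).fn) atTop (𝓝 1) ∧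
    BlissMoser.I N 1 (BlissMoser.W.fn (0 : BlissMoser.W N)) = 1 := by
  refine ⟨fun β hβ => ⟨fun h => ?_, fun h => ?_⟩, fun β => ⟨fun h => ?_, fun h => ?_⟩,
    fun β hβ hβ1 u u₀ hu h => ?_, fun β hβ1 u u₀ hu h => ?_, fun j hj => BlissMoser.moser_mem_E hj,
    BlissMoser.weaklyTendsto_moser, fun β hβ => BlissMoser.tendsto_I_moser_top hβ,
    BlissMoser.tendsto_I_moser_one, BlissMoser.I_zero⟩
  · by_contra! hβ1
    exact h.ne (BlissMoser.iSup_E_eq_top (f := fun v => BlissMoser.I N β v.fn)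
      (BlissMoser.tendsto_I_moser_top hβ1))
  · exact BlissMoser.iSup_E_lt_top fun u hu => BlissMoser.I_le hβ h hu
  · by_contra! hβ1
    exact h.ne (BlissMoser.iSup_E_eq_top (f := fun v => BlissMoser.I N β (fun s => |v.fn s|))
      (BlissMoser.tendsto_I_abs_moser_top hβ1))
  · exact BlissMoser.iSup_E_lt_top fun u hu => BlissMoser.I_abs_le h hu
  · exact BlissMoser.tendsto_I_of_weaklyTendsto hβ1 continuous_id
      (BlissMoser.mul_pow_le_mul_abs_pow hβ) hu h
  · exact BlissMoser.tendsto_I_of_weaklyTendsto hβ1 continuous_abs (fun x => le_rfl) hu h
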